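/- **Definitions.** A *type-theoretic fibration category* is a category with a terminal object $1$ and a subcategory of morphisms called *fibrations* such that: isomorphisms and morphisms into $1$ are fibrations; a fibration has a pullback along every morphism, which is again a fibration; every morphism is an *acyclic cofibration* (a morphism with the left lifting property against all fibrations) followed by a fibration; and for fibrations $f:X\to Y$ and $g:Y\to Z$ there is a *dependent product* of $f$ along $g$, i.e. a fibration $\Pi_g f$ over $Z$ with a bijection $\mathrm{Hom}_{/Z}(h,\Pi_g f)\cong \mathrm{Hom}_{/Y}(g^*h,f)$ natural in $h$. A *type-theoretic functor* is a functor preserving terminal objects, fibrations, pullbacks of fibrations, acyclic cofibrations and dependent products. A *fibred type-theoretic fibration category* is a fibred category $p:\mathcal E\to\mathcal B$ such that $\mathcal E$ and $\mathcal B$ are type-theoretic fibration categories, $p$ is a type-theoretic functor, cartesian morphisms above fibrations (resp. acyclic cofibrations) are fibrations (resp. acyclic cofibrations), and whenever $g:X\to Z$ is a fibration in $\mathcal E$, $pg=t\circ s$ with $s$ a fibration, the morphism $X\to t^*Z$ above $s$ induced by $g$ is a fibration. The *internal language* of $p$ has the following judgments. A kind $\gamma:\Gamma\vdash\Delta(\gamma)$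 is a fibration $\Delta\to\Gamma$ in $\mathcal B$, and a term of it is a section. A type $\gamma:\Gamma\mid a:A(\gamma)\vdash X(\gamma;a)$, where $A$ is an object of the fibre $\mathcal E_\Gamma$, is a morphism $X\to A$ of $\mathcal E_\Gamma$ that is a fibration in $\mathcal E$, and a term of it is a section in $\mathcal E_\Gamma$. Substitution of kind terms in types is reindexing: given a section $s$ of $d:\Delta\to\Gamma$ and a type $q:X\to d^*A$ over $\Delta$ (written $\gamma:\Gamma,\delta:\Delta(\gamma)\mid a:A(\gamma)\vdash X(\gamma,\delta;a)$), the type $\gamma:\Gamma\mid a:A(\gamma)\vdash X(\gamma,s(\gamma);a)$ is the composite $s^*X\xrightarrow{s^*q}s^*d^*A\cong A$. A *Martin-Löf type theory* $M$ is Martin-Löf type theory with $\Pi$-types and $\Sigma$-types (both with $\beta$ and $\eta$) and intensional identity types, possibly extended by further type constants, term constants and equational axioms. Its *syntactic category* $\mathcal T(M)$ has the contexts as objects and the context morphisms up to judgmental equality as morphisms; its fibrations are the composites of context projections $(\Gamma,x:A)\to\Gamma$ and isomorphisms, and its terminal object is the empty context. An *interpretation* of $M$ in $\mathcal C$ is a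 type-theoretic functor $\mathcal T(M)\to\mathcal C$. A *logical predicate* on an interpretation $F:\mathcal T(M)\to\mathcal B$ with respect to $p$ is an interpretation $R:\mathcal T(M)\to\mathcal E$ with $p\circ R=F$. **Basic Lemma.** Let $p:\mathcal E\to\mathcal B$ be a fibred type-theoretic fibration category, with any choice of cartesian liftings, and let $R:\mathcal T(M)\to\mathcal E$ be a logical predicate on an interpretation $F:\mathcal T(M)\to\mathcal B$ of a Martin-Löf type theory $M$. Let $A$ be a closed type of $M$ or, more generally, a context, and let $a:A\vdash t(a):B(a)$ be a term. Write $B$ also for the context $(a:A,\,b:B(a))$, $\pi:B\to A$ for the projection, and $t:A\to B$ for the section of $\pi$ given by the term. Then, in the internal language of $p$: 1. $a:FA\vdash Ft(a):FB(a)$, that is, $F\pi$ is a fibration with section $Ft$; 2. $a:FA,\,b:FB(a)\mid r:RA(a)\vdash RB(a,b;r)$ is a type, given by the morphism $RB\to(F\pi)^*RA$ of $\mathcal E_{FB}$ induced by $R\pi$; 3. there is a term $a:FA\mid r:RA(a)\vdash\hat t(a;r):RB(a,Ft(a);r)$ of the type obtained from 2 by substituting $Ft(a)$ for $b$, where $\hat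 t$ is the morphism $RA\to(Ft)^*RB$ of $\mathcal E_{FA}$ induced by $Rt:RA\to RB$. -/

import Mathlib

open CategoryTheory CategoryTheory.Functor CategoryTheory.Limits

universe u v₁ v₂ u₁ u₂

/-! ## Type-theoretic fibration categories -/

/-- The data of a type-theoretic fibration category: a chosen terminal object and a class of
morphisms, the fibrations. -/
class FibrationStructure (C : Type u₁) [Category.{v₁} C] where
  one : C
  oneIsTerminal : IsTerminal one
  Fib : MorphismProperty C

section TTFC

variable {C : Type u₁} [Category.{v₁} C]

/-- `P`, with `π : P ⟶ Z`, is a dependent product of `f : X ⟶ Y` along `g : Y ⟶ Z`, with counit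
`ε : Q ⟶ X`, where `Q` (with projections `q₁`, `q₂`) is a pullback of `π` along `g`.
The last field says that `k ↦ u` is a bijection from the morphisms `g^* h ⟶ f` over `Y` to the
morphisms `h ⟶ π` over `Z`, for every `h : W ⟶ Z`; it is natural in `h` because its inverse is
`u ↦ g^* u ≫ ε`. -/
structure IsDependentProduct {X Y Z P Q : C} (f : X ⟶ Y) (g : Y ⟶ Z) (π : P ⟶ Z)
    (q₁ : Q ⟶ P) (q₂ : Q ⟶ Y) (ε : Q ⟶ X) : Prop where
  isPullback : IsPullback q₁ q₂ π g
  counit_over : ε ≫ f = q₂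
  existsUnique : ∀ {W V : C} (h : W ⟶ Z) (y₁ : V ⟶ W) (y₂ : V ⟶ Y) (hV : IsPullback y₁ y₂ h g)
    (k : V ⟶ X), k ≫ f = y₂ →
      ∃! u : W ⟶ P, ∃ hu : u ≫ π = h,
        isPullback.lift (y₁ ≫ u) y₂ (by rw [Category.assoc, hu, hV.w]) ≫ ε = k

variable (C) in
/-- Acyclic cofibrations: the morphisms with the left lifting property with respect to all
fibrations. -/
def AcyclicCofib [FibrationStructure C] : MorphismProperty C :=
  (FibrationStructure.Fib (C := C)).llp

variable (C) in
/-- The axioms of a type-theoretic fibration category. -/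
class IsTypeTheoreticFibrationCategory [FibrationStructure C] : Prop where
  fib_of_isIso : ∀ {X Y : C} (f : X ⟶ Y), IsIso f → FibrationStructure.Fib f
  fib_comp : ∀ {X Y Z : C} (f : X ⟶ Y) (g : Y ⟶ Z), FibrationStructure.Fib f →
    FibrationStructure.Fib g → FibrationStructure.Fib (f ≫ g)
  fib_to_one : ∀ {X : C} (f : X ⟶ FibrationStructure.one), FibrationStructure.Fib f
  exists_pullback : ∀ {A B B' : C} (f : A ⟶ B) (s : B' ⟶ B), FibrationStructure.Fib f →
    ∃ (P : C) (a : P ⟶ A) (b : P ⟶ B'), IsPullback a b f s ∧ FibrationStructure.Fib b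
  exists_factorization : ∀ {X Y : C} (f : X ⟶ Y),
    ∃ (Z : C) (i : X ⟶ Z) (q : Z ⟶ Y),
      AcyclicCofib C i ∧ FibrationStructure.Fib q ∧ i ≫ q = f
  exists_dependentProduct : ∀ {X Y Z : C} (f : X ⟶ Y) (g : Y ⟶ Z), FibrationStructure.Fib f →
    FibrationStructure.Fib g →
      ∃ (P Q : C) (π : P ⟶ Z) (q₁ : Q ⟶ P) (q₂ : Q ⟶ Y) (ε : Q ⟶ X),
        FibrationStructure.Fib π ∧ IsDependentProduct f g π q₁ q₂ ε

/-- Type-theoretic functors: functors that preserve terminal objects, fibrations, pullbacks of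
fibrations, acyclic cofibrations and dependent products (of fibrations along fibrations). -/
structure IsTypeTheoreticFunctor {D : Type u₂} [Category.{v₂} D] [FibrationStructure C]
    [FibrationStructure D] (F : C ⥤ D) : Prop where
  map_terminal : Nonempty (IsTerminal (F.obj FibrationStructure.one))
  map_fib : ∀ {X Y : C} (f : X ⟶ Y), FibrationStructure.Fib f → FibrationStructure.Fib (F.map f)
  map_pullback : ∀ {P A B' B : C} (a : P ⟶ A) (b : P ⟶ B') (f : A ⟶ B) (s : B' ⟶ B),
    FibrationStructure.Fib f → IsPullback a b f s →
      IsPullback (F.map a) (F.map b) (F.map f) (F.map s)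
  map_acyclicCofib : ∀ {X Y : C} (i : X ⟶ Y), AcyclicCofib C i → AcyclicCofib D (F.map i)
  map_dependentProduct : ∀ {X Y Z P Q : C} (f : X ⟶ Y) (g : Y ⟶ Z) (π : P ⟶ Z)
    (q₁ : Q ⟶ P) (q₂ : Q ⟶ Y) (ε : Q ⟶ X), FibrationStructure.Fib f → FibrationStructure.Fib g →
      FibrationStructure.Fib π → IsDependentProduct f g π q₁ q₂ ε →
        IsDependentProduct (F.map f) (F.map g) (F.map π) (F.map q₁) (F.map q₂) (F.map ε)

end TTFC

/-! ## Fibred type-theoretic fibration categories and their internal language -/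

/-- Fibred type-theoretic fibration categories. "Cartesian" is read in the strong sense, with the
universal property with respect to morphisms above arbitrary morphisms into the domain. -/
structure IsFibredTypeTheoreticFibrationCategory {E : Type u₁} [Category.{v₁} E] {B : Type u₂}
    [Category.{v₂} B] [FibrationStructure E] [FibrationStructure B] (p : E ⥤ B) : Prop where
  isFibered : p.IsFibered
  total : IsTypeTheoreticFibrationCategory E
  base : IsTypeTheoreticFibrationCategory B
  typeTheoretic : IsTypeTheoreticFunctor p
  /-- cartesian morphisms above fibrations are fibrations -/
  fib_of_cartesian : ∀ {I J : B} {X Y : E} (s : I ⟶ J) (φ : X ⟶ Y),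
    p.IsStronglyCartesian s φ → FibrationStructure.Fib s → FibrationStructure.Fib φ
  /-- if `g : X ⟶ Z` and `s` are fibrations and `χ : Y ⟶ Z` is cartesian above `t`, then the
  morphism `k : X ⟶ Y` above `s` that `g` induces is a fibration -/
  fib_of_induced : ∀ {I J K : B} {X Y Z : E} (s : I ⟶ J) (t : J ⟶ K) (g : X ⟶ Z) (χ : Y ⟶ Z)
    (k : X ⟶ Y), FibrationStructure.Fib g → FibrationStructure.Fib s →
      p.IsStronglyCartesian t χ → p.IsHomLift s k → k ≫ χ = g → FibrationStructure.Fib k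
  /-- cartesian morphisms above acyclic cofibrations are acyclic cofibrations -/
  acyclicCofib_of_cartesian : ∀ {I J : B} {X Y : E} (s : I ⟶ J) (φ : X ⟶ Y),
    p.IsStronglyCartesian s φ → AcyclicCofib B s → AcyclicCofib E φ

/-- A choice of a cartesian lifting `f^* X ⟶ X` of every `f : I ⟶ J` and every `X` above `J`. -/
structure Cleavage {E : Type u₁} [Category.{v₁} E] {B : Type u₂} [Category.{v₂} B]
    (p : E ⥤ B) where
  obj : ∀ {I J : B}, (I ⟶ J) → p.Fiber J → p.Fiber I
  lift : ∀ {I J : B} (f : I ⟶ J) (X : p.Fiber J), (obj f X).1 ⟶ X.1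
  isCartesian : ∀ {I J : B} (f : I ⟶ J) (X : p.Fiber J), p.IsStronglyCartesian f (lift f X)

namespace Cleavage

variable {E : Type u₁} [Category.{v₁} E] {B : Type u₂} [Category.{v₂} B] {p : E ⥤ B}

attribute [instance] Cleavage.isCartesian

/-- Every fibred category has a cleavage. -/
theorem nonempty_of_isFibered [p.IsFibered] : Nonempty (Cleavage p) :=
  ⟨{ obj := fun f X => ⟨IsPreFibered.pullbackObj X.2 f, IsPreFibered.pullbackObj_proj X.2 f⟩
     lift := fun f X => IsPreFibered.pullbackMap X.2 f
     isCartesian := fun _ _ => inferInstance }⟩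

variable (c : Cleavage p)

/-- The morphism `X ⟶ f^* Y` of the fibre over `I` induced by a morphism `φ : X ⟶ Y` above
`f : I ⟶ J`. -/
noncomputable def induced {I J : B} (f : I ⟶ J) {X : p.Fiber I} {Y : p.Fiber J}
    (φ : X.1 ⟶ Y.1) (hφ : p.IsHomLift f φ) : X ⟶ c.obj f Y :=
  ⟨IsCartesian.map p f (c.lift f Y) φ, inferInstance⟩

/-- The characterization of the induced morphism. -/
theorem eq_induced_iff {I J : B} (f : I ⟶ J) {X : p.Fiber I} {Y : p.Fiber J}
    (φ : X.1 ⟶ Y.1) (hφ : p.IsHomLift f φ) (k : X ⟶ c.obj f Y) :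
    k = c.induced f φ hφ ↔ k.1 ≫ c.lift f Y = φ := by
  constructor
  · rintro rfl
    exact IsCartesian.fac p f (c.lift f Y) φ
  · intro h
    have := k.2
    exact Subtype.ext (IsCartesian.map_uniq p f (c.lift f Y) φ k.1 h)

/-- The action of the reindexing functor `f^*` on morphisms. -/
noncomputable def map {I J : B} (f : I ⟶ J) {X Y : p.Fiber J} (m : X ⟶ Y) :
    c.obj f X ⟶ c.obj f Y :=
  c.induced f (c.lift f X ≫ m.1) (by have := m.2; infer_instance)

/-- For a section `s` of `g : J ⟶ I`, the canonical isomorphism `s^* g^* X ≅ X` over `I`. -/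
noncomputable def sectionIso {I J : B} (s : I ⟶ J) (g : J ⟶ I) (h : s ≫ g = 𝟙 I)
    (X : p.Fiber I) : c.obj s (c.obj g X) ≅ X :=
  have hc : p.IsStronglyCartesian (𝟙 I) (c.lift s (c.obj g X) ≫ c.lift g X) := by
    rw [← h]; infer_instance
  have : IsIso (c.lift s (c.obj g X) ≫ c.lift g X) :=
    IsStronglyCartesian.isIso_of_base_isIso p (𝟙 I) _
  { hom := ⟨c.lift s (c.obj g X) ≫ c.lift g X, inferInstance⟩
    inv := ⟨inv (c.lift s (c.obj g X) ≫ c.lift g X), inferInstance⟩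
    hom_inv_id := Subtype.ext (IsIso.hom_inv_id _)
    inv_hom_id := Subtype.ext (IsIso.inv_hom_id _) }

end Cleavage

/-! The judgments of the internal language of `p`. Kind contexts are the objects of the base; kinds
in a kind context `Γ` are the fibrations over `Γ`, and their terms are the sections. The types over
a kind context `Γ` form the internal language of the fibre over `Γ`, whose fibrations are those of
the total category: type contexts are the objects of the fibre, types are the vertical fibrations,
terms are the vertical sections. -/

namespace InternalLanguage

variable {E : Type u₁} [Category.{v₁} E] {B : Type u₂} [Category.{v₂} B]

/-- `γ : Γ ⊢ Δ(γ) kind`, presented by `d : Δ ⟶ Γ`. -/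
def IsKind [FibrationStructure B] {Γ Δ : B} (d : Δ ⟶ Γ) : Prop := FibrationStructure.Fib d

/-- `γ : Γ ⊢ s(γ) : Δ(γ)`. -/
def IsKindTerm [FibrationStructure B] {Γ Δ : B} (d : Δ ⟶ Γ) (s : Γ ⟶ Δ) : Prop :=
  IsKind d ∧ s ≫ d = 𝟙 Γ

variable {p : E ⥤ B}

/-- `γ : Γ | a : A(γ) ⊢ X(γ; a) type`, presented by the vertical morphism `q : X ⟶ A`. -/
def IsType [FibrationStructure E] {Γ : B} {A X : p.Fiber Γ} (q : X ⟶ A) : Prop :=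
  FibrationStructure.Fib (Fiber.fiberInclusion.map q)

/-- `γ : Γ | a : A(γ) ⊢ x(γ; a) : X(γ; a)`. -/
def IsTerm [FibrationStructure E] {Γ : B} {A X : p.Fiber Γ} (q : X ⟶ A) (x : A ⟶ X) : Prop :=
  IsType q ∧ x ≫ q = 𝟙 A

/-- Substitution of a kind term `γ : Γ ⊢ s(γ) : Δ(γ)` for the variable `δ` in a type
`γ : Γ, δ : Δ(γ) | a : A(γ) ⊢ X(γ, δ; a)`: the type `γ : Γ | a : A(γ) ⊢ X(γ, s(γ); a)`. The context
`A(γ)` in the given type is the weakening `d^* A`, and `s^* d^* A` is identified with `A` along the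
canonical isomorphism. -/
noncomputable def substKindTerm (c : Cleavage p) {Γ Δ : B} (d : Δ ⟶ Γ) (s : Γ ⟶ Δ)
    (h : s ≫ d = 𝟙 Γ) {A : p.Fiber Γ} {X : p.Fiber Δ} (q : X ⟶ c.obj d A) : c.obj s X ⟶ A :=
  c.map s q ≫ (c.sectionIso s d h A).hom

end InternalLanguage

/-! ## Martin-Löf type theories

Martin-Löf type theory with Π-, Σ- and identity types, presented with de Bruijn indices and
explicit substitutions, over a collection of type constants and term constants. -/

mutual

/-- Raw types; `sub A σ` is the type `A[σ]`. -/
inductive RawTy (K L : Type u) : Type u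
  | const : K → RawTy K L
  | pi : RawTy K L → RawTy K L → RawTy K L
  | sigma : RawTy K L → RawTy K L → RawTy K L
  | eq : RawTy K L → RawTm K L → RawTm K L → RawTy K L
  | sub : RawTy K L → RawSub K L → RawTy K L

/-- Raw terms; `var` is the last variable of a context, the other variables are weakenings of it.
Term formers carry the types that they involve. -/
inductive RawTm (K L : Type u) : Type u
  | const : L → RawTm K L
  | var : RawTm K L
  | lam : RawTy K L → RawTy K L → RawTm K L → RawTm K L
  | app : RawTy K L → RawTy K L → RawTm K L → RawTm K L → RawTm K L
  | pair : RawTy K L → RawTy K L → RawTm K L → RawTm K L → RawTm K L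
  | fst : RawTy K L → RawTy K L → RawTm K L → RawTm K L
  | snd : RawTy K L → RawTy K L → RawTm K L → RawTm K L
  | refl : RawTy K L → RawTm K L → RawTm K L
  | ind : RawTy K L → RawTy K L → RawTm K L → RawTm K L → RawTm K L → RawTm K L → RawTm K L
  | sub : RawTm K L → RawSub K L → RawTm K L

/-- Raw substitutions (context morphisms): identity, composition in diagrammatic order, the
substitution into the empty context, the weakening `Γ, x : A ⟶ Γ`, and the extension
`⟨σ, a⟩ : Γ ⟶ Δ, x : A` of `σ : Γ ⟶ Δ` by a term `Γ ⊢ a : A[σ]`. -/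
inductive RawSub (K L : Type u) : Type u
  | id : RawSub K L
  | comp : RawSub K L → RawSub K L → RawSub K L
  | bang : RawSub K L
  | wk : RawSub K L
  | ext : RawSub K L → RawTy K L → RawTm K L → RawSub K L

end

/-- Raw contexts. -/
inductive RawCtx (K L : Type u) : Type u
  | nil : RawCtx K L
  | snoc : RawCtx K L → RawTy K L → RawCtx K L

/-- A Martin-Löf type theory: Martin-Löf type theory with Π-, Σ- and identity types, extended by
type constants `Γ ⊢ k type`, term constants `Γ ⊢ l : A`, and equational axioms
`Γ ⊢ A ≡ A'` and `Γ ⊢ a ≡ a' : A`. A constant or an axiom takes effect once the context, the types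
and the terms in its declaration are themselves derivable. -/
structure MartinLofTheory where
  TyConst : Type u
  TmConst : Type u
  tyConstCtx : TyConst → RawCtx TyConst TmConst
  tmConstCtx : TmConst → RawCtx TyConst TmConst
  tmConstTy : TmConst → RawTy TyConst TmConst
  tyEqn : RawCtx TyConst TmConst → RawTy TyConst TmConst → RawTy TyConst TmConst → Prop
  tmEqn : RawCtx TyConst TmConst → RawTy TyConst TmConst → RawTm TyConst TmConst →
    RawTm TyConst TmConst → Prop

namespace MartinLofTheory

section Abbreviations

variable {K L : Type u}

/-- For `σ : Γ ⟶ Δ`, the substitution `Γ, x : A[σ] ⟶ Δ, x : A`. -/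
def up (σ : RawSub K L) (A : RawTy K L) : RawSub K L := .ext (.comp .wk σ) A .var

/-- `⟨id, a⟩ : Γ ⟶ Γ, x : A`. -/
def inst (A : RawTy K L) (a : RawTm K L) : RawSub K L := .ext .id A a

/-- The weakening of `A`. -/
def wkTy (A : RawTy K L) : RawTy K L := .sub A .wk

/-- The type `x = y` in the context `Γ, x : A, y : A`. -/
def eqTy (A : RawTy K L) : RawTy K L := .eq (wkTy (wkTy A)) (.sub .var .wk) .var

/-- The context `Γ, x : A, y : A, z : x = y`. -/
def eqCtx (Γ : RawCtx K L) (A : RawTy K L) : RawCtx K L :=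
  .snoc (.snoc (.snoc Γ A) (wkTy A)) (eqTy A)

/-- `⟨x, x, refl x⟩ : Γ, x : A ⟶ Γ, x : A, y : A, z : x = y`. -/
def reflSub (A : RawTy K L) : RawSub K L :=
  .ext (.ext .id (wkTy A) .var) (eqTy A) (.refl (wkTy A) .var)

/-- `⟨a, b, e⟩ : Γ ⟶ Γ, x : A, y : A, z : x = y`. -/
def eqInst (A : RawTy K L) (a b e : RawTm K L) : RawSub K L :=
  .ext (.ext (inst A a) (wkTy A) b) (eqTy A) e

end Abbreviations

variable (M : MartinLofTheory.{u})

/-! The four equality judgments. The judgments `Γ ctx`, `Γ ⊢ A type`, `Γ ⊢ a : A` and `σ : Γ ⟶ Δ`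
are their reflexive instances `Γ ≡ Γ`, `Γ ⊢ A ≡ A`, `Γ ⊢ a ≡ a : A` and `σ ≡ σ : Γ ⟶ Δ`, so that
a congruence rule is a formation (or introduction, or elimination) rule at the same time. -/

mutual

/-- `Γ ≡ Γ' ctx`. -/
inductive CtxEq : RawCtx M.TyConst M.TmConst → RawCtx M.TyConst M.TmConst → Prop
  | symm {Γ Γ'} : CtxEq Γ Γ' → CtxEq Γ' Γ
  | trans {Γ Γ' Γ''} : CtxEq Γ Γ' → CtxEq Γ' Γ'' → CtxEq Γ Γ''
  | nil : CtxEq .nil .nil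
  | snoc {Γ Γ' A A'} : CtxEq Γ Γ' → TyEq Γ A A' → CtxEq (.snoc Γ A) (.snoc Γ' A')

/-- `Γ ⊢ A ≡ A' type`. -/
inductive TyEq : RawCtx M.TyConst M.TmConst → RawTy M.TyConst M.TmConst →
    RawTy M.TyConst M.TmConst → Prop
  | symm {Γ A A'} : TyEq Γ A A' → TyEq Γ A' A
  | trans {Γ A A' A''} : TyEq Γ A A' → TyEq Γ A' A'' → TyEq Γ A A''
  | conv {Γ Γ' A A'} : CtxEq Γ Γ' → TyEq Γ A A' → TyEq Γ' A A'
  | const (k : M.TyConst) : CtxEq (M.tyConstCtx k) (M.tyConstCtx k) →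
      TyEq (M.tyConstCtx k) (.const k) (.const k)
  | eqn {Γ A A'} : M.tyEqn Γ A A' → TyEq Γ A A → TyEq Γ A' A' → TyEq Γ A A'
  | pi {Γ A A' B B'} : TyEq Γ A A' → TyEq (.snoc Γ A) B B' → TyEq Γ (.pi A B) (.pi A' B')
  | sigma {Γ A A' B B'} : TyEq Γ A A' → TyEq (.snoc Γ A) B B' →
      TyEq Γ (.sigma A B) (.sigma A' B')
  | eq {Γ A A' a a' b b'} : TyEq Γ A A' → TmEq Γ A a a' → TmEq Γ A b b' →
      TyEq Γ (.eq A a b) (.eq A' a' b')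
  | sub {Γ Δ A A' σ σ'} : SubEq Γ Δ σ σ' → TyEq Δ A A' → TyEq Γ (.sub A σ) (.sub A' σ')
  | sub_id {Γ A} : TyEq Γ A A → TyEq Γ (.sub A .id) A
  | sub_comp {Γ Δ Θ A σ τ} : SubEq Γ Δ σ σ → SubEq Δ Θ τ τ → TyEq Θ A A →
      TyEq Γ (.sub A (.comp σ τ)) (.sub (.sub A τ) σ)
  | pi_sub {Γ Δ A B σ} : SubEq Γ Δ σ σ → TyEq Δ A A → TyEq (.snoc Δ A) B B →
      TyEq Γ (.sub (.pi A B) σ) (.pi (.sub A σ) (.sub B (up σ A)))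
  | sigma_sub {Γ Δ A B σ} : SubEq Γ Δ σ σ → TyEq Δ A A → TyEq (.snoc Δ A) B B →
      TyEq Γ (.sub (.sigma A B) σ) (.sigma (.sub A σ) (.sub B (up σ A)))
  | eq_sub {Γ Δ A a b σ} : SubEq Γ Δ σ σ → TyEq Δ A A → TmEq Δ A a a → TmEq Δ A b b →
      TyEq Γ (.sub (.eq A a b) σ) (.eq (.sub A σ) (.sub a σ) (.sub b σ))

/-- `Γ ⊢ a ≡ a' : A`. -/
inductive TmEq : RawCtx M.TyConst M.TmConst → RawTy M.TyConst M.TmConst →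
    RawTm M.TyConst M.TmConst → RawTm M.TyConst M.TmConst → Prop
  | symm {Γ A a a'} : TmEq Γ A a a' → TmEq Γ A a' a
  | trans {Γ A a a' a''} : TmEq Γ A a a' → TmEq Γ A a' a'' → TmEq Γ A a a''
  | conv {Γ Γ' A A' a a'} : CtxEq Γ Γ' → TyEq Γ A A' → TmEq Γ A a a' → TmEq Γ' A' a a'
  | const (l : M.TmConst) : TyEq (M.tmConstCtx l) (M.tmConstTy l) (M.tmConstTy l) →
      TmEq (M.tmConstCtx l) (M.tmConstTy l) (.const l) (.const l)
  | eqn {Γ A a a'} : M.tmEqn Γ A a a' → TmEq Γ A a a → TmEq Γ A a' a' → TmEq Γ A a a'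
  | var {Γ A} : TyEq Γ A A → TmEq (.snoc Γ A) (wkTy A) .var .var
  | sub {Γ Δ A a a' σ σ'} : SubEq Γ Δ σ σ' → TmEq Δ A a a' →
      TmEq Γ (.sub A σ) (.sub a σ) (.sub a' σ')
  | sub_id {Γ A a} : TmEq Γ A a a → TmEq Γ A (.sub a .id) a
  | sub_comp {Γ Δ Θ A a σ τ} : SubEq Γ Δ σ σ → SubEq Δ Θ τ τ → TmEq Θ A a a →
      TmEq Γ (.sub A (.comp σ τ)) (.sub a (.comp σ τ)) (.sub (.sub a τ) σ)
  | var_ext {Γ Δ A a σ} : SubEq Γ Δ σ σ → TyEq Δ A A → TmEq Γ (.sub A σ) a a →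
      TmEq Γ (.sub A σ) (.sub .var (.ext σ A a)) a
  | lam {Γ A A' B B' b b'} : TyEq Γ A A' → TyEq (.snoc Γ A) B B' → TmEq (.snoc Γ A) B b b' →
      TmEq Γ (.pi A B) (.lam A B b) (.lam A' B' b')
  | app {Γ A A' B B' f f' a a'} : TyEq Γ A A' → TyEq (.snoc Γ A) B B' →
      TmEq Γ (.pi A B) f f' → TmEq Γ A a a' →
      TmEq Γ (.sub B (inst A a)) (.app A B f a) (.app A' B' f' a')
  | pi_beta {Γ A B b a} : TyEq Γ A A → TyEq (.snoc Γ A) B B → TmEq (.snoc Γ A) B b b →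
      TmEq Γ A a a →
      TmEq Γ (.sub B (inst A a)) (.app A B (.lam A B b) a) (.sub b (inst A a))
  | pi_eta {Γ A B f} : TyEq Γ A A → TyEq (.snoc Γ A) B B → TmEq Γ (.pi A B) f f →
      TmEq Γ (.pi A B) f
        (.lam A B (.app (wkTy A) (.sub B (up .wk A)) (.sub f .wk) .var))
  | lam_sub {Γ Δ A B b σ} : SubEq Γ Δ σ σ → TyEq Δ A A → TyEq (.snoc Δ A) B B →
      TmEq (.snoc Δ A) B b b →
      TmEq Γ (.sub (.pi A B) σ) (.sub (.lam A B b) σ)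
        (.lam (.sub A σ) (.sub B (up σ A)) (.sub b (up σ A)))
  | app_sub {Γ Δ A B f a σ} : SubEq Γ Δ σ σ → TyEq Δ A A → TyEq (.snoc Δ A) B B →
      TmEq Δ (.pi A B) f f → TmEq Δ A a a →
      TmEq Γ (.sub (.sub B (inst A a)) σ) (.sub (.app A B f a) σ)
        (.app (.sub A σ) (.sub B (up σ A)) (.sub f σ) (.sub a σ))
  | pair {Γ A A' B B' a a' b b'} : TyEq Γ A A' → TyEq (.snoc Γ A) B B' → TmEq Γ A a a' →
      TmEq Γ (.sub B (inst A a)) b b' →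
      TmEq Γ (.sigma A B) (.pair A B a b) (.pair A' B' a' b')
  | fst {Γ A A' B B' c c'} : TyEq Γ A A' → TyEq (.snoc Γ A) B B' →
      TmEq Γ (.sigma A B) c c' → TmEq Γ A (.fst A B c) (.fst A' B' c')
  | snd {Γ A A' B B' c c'} : TyEq Γ A A' → TyEq (.snoc Γ A) B B' →
      TmEq Γ (.sigma A B) c c' →
      TmEq Γ (.sub B (inst A (.fst A B c))) (.snd A B c) (.snd A' B' c')
  | fst_pair {Γ A B a b} : TyEq Γ A A → TyEq (.snoc Γ A) B B → TmEq Γ A a a →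
      TmEq Γ (.sub B (inst A a)) b b → TmEq Γ A (.fst A B (.pair A B a b)) a
  | snd_pair {Γ A B a b} : TyEq Γ A A → TyEq (.snoc Γ A) B B → TmEq Γ A a a →
      TmEq Γ (.sub B (inst A a)) b b →
      TmEq Γ (.sub B (inst A a)) (.snd A B (.pair A B a b)) b
  | sigma_eta {Γ A B c} : TyEq Γ A A → TyEq (.snoc Γ A) B B → TmEq Γ (.sigma A B) c c →
      TmEq Γ (.sigma A B) c (.pair A B (.fst A B c) (.snd A B c))
  | pair_sub {Γ Δ A B a b σ} : SubEq Γ Δ σ σ → TyEq Δ A A → TyEq (.snoc Δ A) B B →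
      TmEq Δ A a a → TmEq Δ (.sub B (inst A a)) b b →
      TmEq Γ (.sub (.sigma A B) σ) (.sub (.pair A B a b) σ)
        (.pair (.sub A σ) (.sub B (up σ A)) (.sub a σ) (.sub b σ))
  | fst_sub {Γ Δ A B c σ} : SubEq Γ Δ σ σ → TyEq Δ A A → TyEq (.snoc Δ A) B B →
      TmEq Δ (.sigma A B) c c →
      TmEq Γ (.sub A σ) (.sub (.fst A B c) σ)
        (.fst (.sub A σ) (.sub B (up σ A)) (.sub c σ))
  | snd_sub {Γ Δ A B c σ} : SubEq Γ Δ σ σ → TyEq Δ A A → TyEq (.snoc Δ A) B B →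
      TmEq Δ (.sigma A B) c c →
      TmEq Γ (.sub (.sub B (inst A (.fst A B c))) σ) (.sub (.snd A B c) σ)
        (.snd (.sub A σ) (.sub B (up σ A)) (.sub c σ))
  | refl {Γ A A' a a'} : TyEq Γ A A' → TmEq Γ A a a' →
      TmEq Γ (.eq A a a) (.refl A a) (.refl A' a')
  | refl_sub {Γ Δ A a σ} : SubEq Γ Δ σ σ → TyEq Δ A A → TmEq Δ A a a →
      TmEq Γ (.sub (.eq A a a) σ) (.sub (.refl A a) σ) (.refl (.sub A σ) (.sub a σ))
  | ind {Γ A A' C C' d d' a a' b b' e e'} : TyEq Γ A A' → TyEq (eqCtx Γ A) C C' →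
      TmEq (.snoc Γ A) (.sub C (reflSub A)) d d' → TmEq Γ A a a' → TmEq Γ A b b' →
      TmEq Γ (.eq A a b) e e' →
      TmEq Γ (.sub C (eqInst A a b e)) (.ind A C d a b e) (.ind A' C' d' a' b' e')
  | ind_beta {Γ A C d a} : TyEq Γ A A → TyEq (eqCtx Γ A) C C →
      TmEq (.snoc Γ A) (.sub C (reflSub A)) d d → TmEq Γ A a a →
      TmEq Γ (.sub C (eqInst A a a (.refl A a))) (.ind A C d a a (.refl A a))
        (.sub d (inst A a))
  | ind_sub {Γ Δ A C d a b e σ} : SubEq Γ Δ σ σ → TyEq Δ A A → TyEq (eqCtx Δ A) C C →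
      TmEq (.snoc Δ A) (.sub C (reflSub A)) d d → TmEq Δ A a a → TmEq Δ A b b →
      TmEq Δ (.eq A a b) e e →
      TmEq Γ (.sub (.sub C (eqInst A a b e)) σ) (.sub (.ind A C d a b e) σ)
        (.ind (.sub A σ) (.sub C (up (up (up σ A) (wkTy A)) (eqTy A))) (.sub d (up σ A))
          (.sub a σ) (.sub b σ) (.sub e σ))

/-- `σ ≡ σ' : Γ ⟶ Δ`. -/
inductive SubEq : RawCtx M.TyConst M.TmConst → RawCtx M.TyConst M.TmConst →
    RawSub M.TyConst M.TmConst → RawSub M.TyConst M.TmConst → Prop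
  | symm {Γ Δ σ σ'} : SubEq Γ Δ σ σ' → SubEq Γ Δ σ' σ
  | trans {Γ Δ σ σ' σ''} : SubEq Γ Δ σ σ' → SubEq Γ Δ σ' σ'' → SubEq Γ Δ σ σ''
  | conv {Γ Γ' Δ Δ' σ σ'} : CtxEq Γ Γ' → CtxEq Δ Δ' → SubEq Γ Δ σ σ' → SubEq Γ' Δ' σ σ'
  | id {Γ} : CtxEq Γ Γ → SubEq Γ Γ .id .id
  | comp {Γ Δ Θ σ σ' τ τ'} : SubEq Γ Δ σ σ' → SubEq Δ Θ τ τ' →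
      SubEq Γ Θ (.comp σ τ) (.comp σ' τ')
  | id_comp {Γ Δ σ} : SubEq Γ Δ σ σ → SubEq Γ Δ (.comp .id σ) σ
  | comp_id {Γ Δ σ} : SubEq Γ Δ σ σ → SubEq Γ Δ (.comp σ .id) σ
  | assoc {Γ Δ Θ Ξ σ τ ρ} : SubEq Γ Δ σ σ → SubEq Δ Θ τ τ → SubEq Θ Ξ ρ ρ →
      SubEq Γ Ξ (.comp (.comp σ τ) ρ) (.comp σ (.comp τ ρ))
  | bang {Γ} : CtxEq Γ Γ → SubEq Γ .nil .bang .bang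
  | eq_bang {Γ σ} : SubEq Γ .nil σ σ → SubEq Γ .nil σ .bang
  | wk {Γ A} : TyEq Γ A A → SubEq (.snoc Γ A) Γ .wk .wk
  | ext {Γ Δ A A' a a' σ σ'} : SubEq Γ Δ σ σ' → TyEq Δ A A' → TmEq Γ (.sub A σ) a a' →
      SubEq Γ (.snoc Δ A) (.ext σ A a) (.ext σ' A' a')
  | ext_wk {Γ Δ A a σ} : SubEq Γ Δ σ σ → TyEq Δ A A → TmEq Γ (.sub A σ) a a →
      SubEq Γ Δ (.comp (.ext σ A a) .wk) σ
  | ext_eta {Γ Δ A σ} : TyEq Δ A A → SubEq Γ (.snoc Δ A) σ σ →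
      SubEq Γ (.snoc Δ A) σ (.ext (.comp σ .wk) A (.sub .var σ))

end

/-- Contexts. -/
structure Ctx where
  raw : RawCtx M.TyConst M.TmConst
  isCtx : M.CtxEq raw raw

variable {M}

/-- Types `Γ ⊢ A type`. -/
structure Ty (Γ : M.Ctx) where
  raw : RawTy M.TyConst M.TmConst
  isTy : M.TyEq Γ.raw raw raw

/-- Terms `Γ ⊢ a : A`. -/
structure Tm (Γ : M.Ctx) (A : Ty Γ) where
  raw : RawTm M.TyConst M.TmConst
  isTm : M.TmEq Γ.raw A.raw raw raw

/-- Context morphisms up to judgmental equality. -/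
def homSetoid (Γ Δ : M.Ctx) :
    Setoid {σ : RawSub M.TyConst M.TmConst // M.SubEq Γ.raw Δ.raw σ σ} where
  r σ τ := M.SubEq Γ.raw Δ.raw σ.1 τ.1
  iseqv := ⟨fun σ => σ.2, fun h => h.symm, fun h h' => h.trans h'⟩

/-- The syntactic category of a Martin-Löf type theory: objects are the contexts, morphisms are the
context morphisms up to judgmental equality. -/
instance syntacticCategory : Category M.Ctx where
  Hom Γ Δ := Quotient (homSetoid Γ Δ)
  id Γ := Quotient.mk _ ⟨.id, .id Γ.isCtx⟩
  comp := Quotient.map₂ (fun σ τ => ⟨.comp σ.1 τ.1, .comp σ.2 τ.2⟩)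
    (fun _ _ h _ _ h' => SubEq.comp h h')
  id_comp := by rintro _ _ ⟨σ⟩; exact Quotient.sound (SubEq.id_comp σ.2)
  comp_id := by rintro _ _ ⟨σ⟩; exact Quotient.sound (SubEq.comp_id σ.2)
  assoc := by
    rintro _ _ _ _ ⟨σ⟩ ⟨τ⟩ ⟨ρ⟩; exact Quotient.sound (SubEq.assoc σ.2 τ.2 ρ.2)

/-- The empty context. -/
def Ctx.empty : M.Ctx := ⟨.nil, .nil⟩

/-- The extended context `Γ, x : A`. -/
def Ctx.ext (Γ : M.Ctx) (A : Ty Γ) : M.Ctx := ⟨.snoc Γ.raw A.raw, .snoc Γ.isCtx A.isTy⟩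

/-- The projection `(Γ, x : A) ⟶ Γ`. -/
def Ty.proj {Γ : M.Ctx} (A : Ty Γ) : Γ.ext A ⟶ Γ := Quotient.mk _ ⟨.wk, .wk A.isTy⟩

/-- The context morphism `⟨id, a⟩ : Γ ⟶ (Γ, x : A)` given by a term `Γ ⊢ a : A`. -/
def Tm.toHom {Γ : M.Ctx} {A : Ty Γ} (a : Tm Γ A) : Γ ⟶ Γ.ext A :=
  Quotient.mk _ ⟨inst A.raw a.raw,
    .ext (.id Γ.isCtx) A.isTy (.conv Γ.isCtx (.symm (.sub_id A.isTy)) a.isTm)⟩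

theorem Tm.toHom_proj {Γ : M.Ctx} {A : Ty Γ} (a : Tm Γ A) : a.toHom ≫ A.proj = 𝟙 Γ :=
  Quotient.sound (SubEq.ext_wk (.id Γ.isCtx) A.isTy
    (.conv Γ.isCtx (.symm (.sub_id A.isTy)) a.isTm))

/-- The fibrations of the syntactic category: the composites of projections and isomorphisms. -/
inductive SyntacticFib : ∀ {Γ Δ : M.Ctx}, (Γ ⟶ Δ) → Prop
  | of_isIso {Γ Δ : M.Ctx} (f : Γ ⟶ Δ) : IsIso f → SyntacticFib f
  | proj {Γ : M.Ctx} (A : Ty Γ) : SyntacticFib A.proj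
  | comp {Γ Δ Θ : M.Ctx} (f : Γ ⟶ Δ) (g : Δ ⟶ Θ) : SyntacticFib f → SyntacticFib g →
      SyntacticFib (f ≫ g)

instance : FibrationStructure M.Ctx where
  one := Ctx.empty
  oneIsTerminal := IsTerminal.ofUniqueHom
    (fun Γ => Quotient.mk _ ⟨.bang, .bang Γ.isCtx⟩)
    (by rintro _ ⟨σ⟩; exact Quotient.sound (SubEq.eq_bang σ.2))
  Fib := fun _ _ f => SyntacticFib f

variable (M)

/-- An interpretation of `M` in `C`: a type-theoretic functor from the syntactic category. -/
structure Interpretation (C : Type u₁) [Category.{v₁} C] [FibrationStructure C] where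
  functor : M.Ctx ⥤ C
  isTypeTheoretic : IsTypeTheoreticFunctor functor

end MartinLofTheory

/-! ## Logical predicates -/

/-- A logical predicate on the interpretation `F` with respect to `p`. -/
structure LogicalPredicate {M : MartinLofTheory.{u}} {E : Type u₁} [Category.{v₁} E]
    {B : Type u₂} [Category.{v₂} B] [FibrationStructure E] [FibrationStructure B] (p : E ⥤ B)
    (F : M.Interpretation B) extends M.Interpretation E where
  comp_eq : functor ⋙ p = F.functor

namespace LogicalPredicate

variable {M : MartinLofTheory.{u}} {E : Type u₁} [Category.{v₁} E] {B : Type u₂}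
  [Category.{v₂} B] [FibrationStructure E] [FibrationStructure B] {p : E ⥤ B}
  {F : M.Interpretation B} (R : LogicalPredicate p F)

/-- `R Γ`, as an object of the fibre over `F Γ`. -/
def obj (Γ : M.Ctx) : p.Fiber (F.functor.obj Γ) :=
  ⟨R.functor.obj Γ, Functor.congr_obj R.comp_eq Γ⟩

/-- `R σ` is above `F σ`. -/
theorem isHomLift {Γ Δ : M.Ctx} (σ : Γ ⟶ Δ) :
    p.IsHomLift (F.functor.map σ) (R.functor.map σ) := by
  rw [← R.comp_eq]
  exact IsHomLift.map p (R.functor.map σ)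

/-- For `σ : Γ ⟶ Δ`, the morphism `R Γ ⟶ (F σ)^* R Δ` of the fibre over `F Γ` induced by `R σ`. -/
noncomputable def induced (c : Cleavage p) {Γ Δ : M.Ctx} (σ : Γ ⟶ Δ) :
    R.obj Γ ⟶ c.obj (F.functor.map σ) (R.obj Δ) :=
  c.induced (F.functor.map σ) (X := R.obj Γ) (Y := R.obj Δ) (R.functor.map σ) (R.isHomLift σ)

end LogicalPredicate

theorem MartinLofTheory.Interpretation.map_section {M : MartinLofTheory.{u}} {B : Type u₂}
    [Category.{v₂} B] [FibrationStructure B] (F : M.Interpretation B) {A : M.Ctx}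
    {T : MartinLofTheory.Ty A} (t : MartinLofTheory.Tm A T) :
    F.functor.map t.toHom ≫ F.functor.map T.proj = 𝟙 (F.functor.obj A) := by
  rw [← F.functor.map_comp, t.toHom_proj, F.functor.map_id]

-- Reindexing of vertical morphisms as pullback along cartesian liftings.

namespace Cleavage

variable {E : Type u₁} [Category.{v₁} E] {B : Type u₂} [Category.{v₂} B] {p : E ⥤ B}
  (c : Cleavage p)

-- The type theory enters only through `π` and `t`: the projection `π` is a fibration and `t` is a
-- section of it. Type-theoretic functors preserve the former and all functors preserve the latter,
-- so `Fπ` and `Rπ` are fibrations with sections `Ft` and `Rt`.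
--
-- The vertical part `q : RB ⟶ (Fπ)^* RA` of `Rπ` is a fibration by the axiom on induced morphisms.
-- Substituting `Ft` for the variable `b` means reindexing `q` along `Ft` and composing with an
-- isomorphism. Reindexing preserves vertical fibrations because it is a pullback in the total
-- category (`isPullback_map`, `fib_map`), so the substituted type is again a type.
--
-- The canonical isomorphism `(Ft)^* (Fπ)^* RA ≅ RA` is the composite of the two cartesian liftings.
-- The equation making the vertical part of `Rt` a section of the substituted type therefore unfolds
-- to `Rt ≫ Rπ = 𝟙`.

/-- Objects of a fibre lie above their base object only up to a propositional equality, so `p.map φ`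
need not have the required codomain on the nose. -/
theorem exists_isHomLift {X Y : E} (φ : X ⟶ Y) {I : B} (hY : p.obj Y = I) :
    ∃ g : p.obj X ⟶ I, p.IsHomLift g φ := by
  subst hY
  exact ⟨p.map φ, inferInstance⟩

theorem induced_lift {I J : B} (f : I ⟶ J) {X : p.Fiber I} {Y : p.Fiber J}
    (φ : X.1 ⟶ Y.1) (hφ : p.IsHomLift f φ) : (c.induced f φ hφ).1 ≫ c.lift f Y = φ :=
  (c.eq_induced_iff f φ hφ _).1 rfl

theorem map_lift {I J : B} (f : I ⟶ J) {X Y : p.Fiber J} (m : X ⟶ Y) :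
    (c.map f m).1 ≫ c.lift f Y = c.lift f X ≫ m.1 :=
  c.induced_lift f _ _

/-- The reindexing `f^* m` of a vertical morphism `m` is its pullback along the cartesian lifting
of `f`. -/
theorem isPullback_map {I J : B} (f : I ⟶ J) {X Y : p.Fiber J} (m : X ⟶ Y) :
    IsPullback (c.lift f X) (c.map f m).1 m.1 (c.lift f Y) := by
  -- The apex of the cone is an arbitrary object of the total category, not one of the fibre, which
  -- is why the strong form of cartesianness is needed.
  have hm : ∀ s : PullbackCone m.1 (c.lift f Y), ∃! k : s.pt ⟶ (c.obj f X).1,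
      k ≫ c.lift f X = s.fst ∧ k ≫ (c.map f m).1 = s.snd := by
    intro s
    have := m.2
    have := (c.map f m).2
    obtain ⟨g, hg⟩ := exists_isHomLift s.snd (c.obj f Y).2
    obtain ⟨g', hg'⟩ := exists_isHomLift s.fst X.2
    have hfst : p.IsHomLift (g ≫ f) (s.fst ≫ m.1) := by
      rw [s.condition]; infer_instance
    have hfst' : p.IsHomLift g' (s.fst ≫ m.1) := inferInstance
    -- The diagonal of the cone lies above `g'`, since `m` is vertical, and above `g ≫ f`, by the
    -- commutativity of the cone.
    have hgg' : g' = g ≫ f :=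
      (IsHomLift.fac p g' (s.fst ≫ m.1)).trans (IsHomLift.fac p (g ≫ f) (s.fst ≫ m.1)).symm
    obtain ⟨k, ⟨hk, hkX⟩, huniq⟩ :=
      IsStronglyCartesian.universal_property p f (c.lift f X) g g' hgg' s.fst
    have hkY : k ≫ (c.map f m).1 = s.snd := by
      -- Both sides lie above `g`, so they can be compared after composition with the cartesian
      -- lifting.
      refine IsStronglyCartesian.ext p f (c.lift f Y) g ?_
      rw [Category.assoc, c.map_lift, reassoc_of% hkX, s.condition]
    refine ⟨k, ⟨hkX, hkY⟩, fun l hl => huniq l ⟨?_, hl.1⟩⟩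
    -- Uniqueness is only available among morphisms above `g`. A competitor `l` lies above `g`
    -- because composing it with a vertical morphism gives `s.snd`.
    obtain ⟨h, hh⟩ := exists_isHomLift l (c.obj f X).2
    have hl' : p.IsHomLift h s.snd := by rw [← hl.2]; infer_instance
    rwa [(IsHomLift.fac p g s.snd).trans (IsHomLift.fac p h s.snd).symm]
  exact ⟨⟨(c.map_lift f m).symm⟩, ⟨PullbackCone.IsLimit.mk _ (fun s => (hm s).choose)
    (fun s => (hm s).choose_spec.1.1) (fun s => (hm s).choose_spec.1.2)
    (fun s k h₁ h₂ => (hm s).choose_spec.2 k ⟨h₁, h₂⟩)⟩⟩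

/-- Reindexing preserves vertical fibrations. -/
theorem fib_map [FibrationStructure E] [IsTypeTheoreticFibrationCategory E] {I J : B} (f : I ⟶ J)
    {X Y : p.Fiber J} (m : X ⟶ Y) (hm : FibrationStructure.Fib m.1) :
    FibrationStructure.Fib (c.map f m).1 := by
  -- The axiom yields some pullback whose projection is a fibration; the reindexed morphism differs
  -- from that projection by an isomorphism.
  obtain ⟨P, a, b, hP, hb⟩ :=
    IsTypeTheoreticFibrationCategory.exists_pullback m.1 (c.lift f Y) hm
  rw [← (c.isPullback_map f m).isoIsPullback_hom_snd _ _ hP]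
  exact IsTypeTheoreticFibrationCategory.fib_comp _ _
    (IsTypeTheoreticFibrationCategory.fib_of_isIso _ inferInstance) hb

end Cleavage

/-- The basic lemma for logical predicates. The context `A` is arbitrary, in particular it may be a single variable
`a : A` of a closed type. Let `π : (A, b : T) ⟶ A` be the projection and let `t` also denote the
section of `π` given by the term `a : A ⊢ t(a) : T(a)`. The three conjuncts are the judgments
* `a : F A ⊢ F t (a) : F T (a)`,
* `a : F A, b : F T (a) | r : R A (a) ⊢ R T (a, b; r) type`, presented by the morphism
  `R (A, b : T) ⟶ (F π)^* (R A)` induced by `R π`,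
* `a : F A | r : R A (a) ⊢ t' (a; r) : R T (a, F t (a); r)`, where `t'` is the morphism
  `R A ⟶ (F t)^* (R (A, b : T))` induced by `R t`. -/
theorem mainTheorem11 {E : Type u₁} [Category.{v₁} E] {B : Type u₂} [Category.{v₂} B]
    [FibrationStructure E] [FibrationStructure B] (p : E ⥤ B)
    (hp : IsFibredTypeTheoreticFibrationCategory p) (c : Cleavage p)
    (M : MartinLofTheory.{u}) (F : M.Interpretation B) (R : LogicalPredicate p F)
    (A : M.Ctx) (T : MartinLofTheory.Ty A) (t : MartinLofTheory.Tm A T) :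
    InternalLanguage.IsKindTerm (F.functor.map T.proj) (F.functor.map t.toHom) ∧
    InternalLanguage.IsType (R.induced c T.proj) ∧
    InternalLanguage.IsTerm
      (InternalLanguage.substKindTerm c (F.functor.map T.proj) (F.functor.map t.toHom)
        (F.map_section t) (R.induced c T.proj))
      (R.induced c t.toHom) := by
  have := hp.total
  have hfib : FibrationStructure.Fib (R.induced c T.proj).1 :=
    -- The factorization of `Fπ` is the trivial one, `𝟙 ≫ Fπ`, so that the induced morphism is
    -- vertical.
    hp.fib_of_induced (𝟙 _) (F.functor.map T.proj) (R.functor.map T.proj)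
      (c.lift (F.functor.map T.proj) (R.obj A)) _
      (R.isTypeTheoretic.map_fib _ (.proj T)) (hp.base.fib_of_isIso _ inferInstance)
      (c.isCartesian _ _) (R.induced c T.proj).2 (c.induced_lift _ _ _)
  refine ⟨⟨F.isTypeTheoretic.map_fib _ (.proj T), F.map_section t⟩, hfib, ?_, ?_⟩
  · exact IsTypeTheoreticFibrationCategory.fib_comp _ _ (c.fib_map _ _ hfib)
      (IsTypeTheoreticFibrationCategory.fib_of_isIso _
        (inferInstanceAs (IsIso (Fiber.fiberInclusion.map (c.sectionIso _ _ (F.map_section t) _).hom))))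
  · refine Subtype.ext ?_
    have hπ : (R.induced c T.proj).1 ≫ c.lift (F.functor.map T.proj) (R.obj A) =
        R.functor.map T.proj := c.induced_lift _ _ _
    have ht : (R.induced c t.toHom).1 ≫ c.lift (F.functor.map t.toHom) (R.obj (A.ext T)) =
        R.functor.map t.toHom := c.induced_lift _ _ _
    have hs := c.map_lift (F.functor.map t.toHom) (R.induced c T.proj)
    have hcomp : R.functor.map t.toHom ≫ R.functor.map T.proj = 𝟙 (R.functor.obj A) := by
      rw [← R.functor.map_comp, t.toHom_proj, R.functor.map_id]
    rw [← hπ, ← ht] at hcomp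
    -- The isomorphism in the substituted type is unfolded into its two cartesian liftings. Moving
    -- the reindexed morphism past the first of them turns the left side into `Rt ≫ Rπ`, each factor
    -- written as its vertical part followed by a lifting.
    change (R.induced c t.toHom).1 ≫ (c.map (F.functor.map t.toHom) (R.induced c T.proj)).1 ≫
      c.lift (F.functor.map t.toHom) (c.obj (F.functor.map T.proj) (R.obj A)) ≫
        c.lift (F.functor.map T.proj) (R.obj A) = 𝟙 (R.obj A).1
    rw [reassoc_of% hs]
    exact (Category.assoc _ _ _).symm.trans hcomp
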